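/- Let $(X,Y)$ be a dual pair of real locally convex spaces: a bilinear form $\langle\cdot,\cdot\rangle$ on $Y\times X$ separates the points of $X$ and of $Y$, and the topologies are compatible with it, i.e. the continuous linear functionals on $X$ are exactly the maps $\langle y,\cdot\rangle$ with $y\in Y$, and those on $Y$ are exactly the maps $\langle\cdot,x\rangle$ with $x\in X$. Let $\Phi:X\to\mathbb{R}\cup\{+\infty\}$ be proper, convex and lower semicontinuous, and write $\operatorname{dom}\Phi=\{x\mid\Phi(x)<+\infty\}$ and $[\Phi\le r]=\{x\in X\mid\Phi(x)\le r\}$. For $S\subset X$, $x\in X$ and $\delta\ge 0$ put $\mathrm{N}^{\delta}_{S}(x)=\{x^*\in Y\mid\langle x^*,u-x\rangle\le\delta\ \ \forall u\in S\}$ and $\mathrm{N}_S(x)=\mathrm{N}^0_S(x)$. For a proper function $f:X\to\mathbb{R}\cup\{+\infty\}$, $\varepsilon\ge0$ and $x\in\operatorname{dom}f$ put $$\partial_\varepsilon f(x)=\{x^*\in Y\mid\langle x^*,u-x\rangle\le f(u)-f(x)+\varepsilon\ \ \forall u\in X\},$$ $\partial_\varepsilon f(x)=\emptyset$ if $\varepsilon<0$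 or $x\notin\operatorname{dom}f$, and $\partial f=\partial_0 f$. For $\mu\ge0$, $\mu\Phi$ is the pointwise multiple with $0\cdot(+\infty)=+\infty$, so that $0\Phi$ is the indicator function of $\operatorname{dom}\Phi$. For $\delta\ge 0$ and $\bar x\in X$, the set $$\limsup_{\mu\varepsilon\to\delta,\ \mu\to+\infty}\mu\,\partial_\varepsilon\Phi(\bar x)$$ is the Painlevé–Kuratowski upper limit in the topology of $Y$: it consists of all $v\in Y$ such that for every neighbourhood $W$ of $v$, every $\eta>0$ and every $M\in\mathbb{R}$ there are $\mu,\varepsilon\in\mathbb{R}$ with $\mu\ge M$, $|\mu\varepsilon-\delta|<\eta$ and $\mu\,\partial_\varepsilon\Phi(\bar x)\cap W\neq\emptyset$. Then for every $\bar x\in\operatorname{dom}\Phi$ and every $\delta\ge0$, $$\mathrm{N}^{\delta}_{[\Phi\le\Phi(\bar x)]}(\bar x)=\bigcup_{\mu\ge0}\partial_\delta(\mu\Phi)(\bar x)\ \cup\ \limsup_{\mu\varepsilon\to\delta,\ \mu\to+\infty}\mu\,\partial_\varepsilon\Phi(\bar x),$$ and, in particular, $$\mathrm{N}_{[\Phi\le\Phi(\bar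 x)]}(\bar x)=\mathbb{R}_+\partial\Phi(\bar x)\ \cup\ \mathrm{N}_{\operatorname{dom}\Phi}(\bar x)\ \cup\ \limsup_{\mu\varepsilon\to0,\ \mu\to+\infty}\mu\,\partial_\varepsilon\Phi(\bar x),$$ where $\mathbb{R}_+\partial\Phi(\bar x)=\{rx^*\mid r\ge0,\ x^*\in\partial\Phi(\bar x)\}$. Moreover, if Slater's condition holds at $\Phi(\bar x)$, that is, if $\Phi(x_0)<\Phi(\bar x)$ for some $x_0\in X$, then for every $\delta\ge0$ $$\mathrm{N}^{\delta}_{[\Phi\le\Phi(\bar x)]}(\bar x)=\bigcup_{\mu\ge0}\partial_\delta(\mu\Phi)(\bar x).$$ -/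

import Mathlib

open Filter Topology
open scoped Pointwise

namespace SublevelNormal

/-- `(X, Y)` is a dual pair under the bilinear form `B`, `⟨y, x⟩ = B x y`: the form separates the
points of both spaces, and the topologies of `X` and `Y` are compatible with it, that is, the
continuous linear functionals on `X` are exactly the maps `⟨y, ·⟩`, `y ∈ Y`, and the continuous
linear functionals on `Y` are exactly the maps `⟨·, x⟩`, `x ∈ X`. -/
structure IsDualPair {X Y : Type*} [AddCommGroup X] [Module ℝ X] [TopologicalSpace X]
    [AddCommGroup Y] [Module ℝ Y] [TopologicalSpace Y] (B : X →ₗ[ℝ] Y →ₗ[ℝ] ℝ) : Prop where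
  separatingLeft : B.SeparatingLeft
  separatingRight : B.SeparatingRight
  compatibleLeft : ∀ f : X →ₗ[ℝ] ℝ, Continuous f ↔ ∃ y : Y, f = B.flip y
  compatibleRight : ∀ g : Y →ₗ[ℝ] ℝ, Continuous g ↔ ∃ x : X, g = B x

section Functions

variable {X : Type*}

/-- The effective domain `{x | Φ x < +∞}`. -/
def dom (Φ : X → EReal) : Set X := {x | Φ x < ⊤}

/-- The sublevel set `[Φ ≤ r]`. -/
def sublevel (Φ : X → EReal) (r : EReal) : Set X := {x | Φ x ≤ r}

/-- The epigraph of `Φ`, a subset of `X × ℝ`. -/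
def epi (Φ : X → EReal) : Set (X × ℝ) := {p | Φ p.1 ≤ (p.2 : EReal)}

/-- `Φ ∈ Γ₀(X)`: `Φ` takes values in `ℝ ∪ {+∞}`, has nonempty effective domain, is convex (its
epigraph is convex) and lower semicontinuous (its epigraph is closed). -/
structure IsGammaZero [AddCommGroup X] [Module ℝ X] [TopologicalSpace X] (Φ : X → EReal) :
    Prop where
  ne_bot : ∀ x, Φ x ≠ ⊥
  dom_nonempty : (dom Φ).Nonempty
  convex_epi : Convex ℝ (epi Φ)
  isClosed_epi : IsClosed (epi Φ)

open Classical in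
/-- The multiple `μΦ`, with the convention `0 · (+∞) = +∞` of convex analysis; thus `0Φ` is the
indicator function of `dom Φ`. -/
noncomputable def scale (μ : ℝ) (Φ : X → EReal) : X → EReal :=
  fun x => if Φ x = ⊤ then ⊤ else (μ : EReal) * Φ x

/-- Slater's condition at the level `r`. -/
def SlaterAt (Φ : X → EReal) (r : EReal) : Prop := ∃ x₀, Φ x₀ < r

end Functions

section Dual

variable {X Y : Type*} [AddCommGroup X] [Module ℝ X] [AddCommGroup Y] [Module ℝ Y]

/-- The `δ`-normal set to `S` at `x`. -/
def normalSet (B : X →ₗ[ℝ] Y →ₗ[ℝ] ℝ) (δ : ℝ) (S : Set X) (x : X) : Set Y :=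
  {y | ∀ u ∈ S, B (u - x) y ≤ δ}

/-- The normal cone to `S` at `x`. -/
def normalCone (B : X →ₗ[ℝ] Y →ₗ[ℝ] ℝ) (S : Set X) (x : X) : Set Y := normalSet B 0 S x

/-- The `ε`-subdifferential of `Φ` at `x`; it is empty if `ε < 0` or `x ∉ dom Φ`. -/
def epsSubdiff (B : X →ₗ[ℝ] Y →ₗ[ℝ] ℝ) (ε : ℝ) (Φ : X → EReal) (x : X) : Set Y :=
  {y | 0 ≤ ε ∧ x ∈ dom Φ ∧ ∀ u, ((B (u - x) y : ℝ) : EReal) ≤ Φ u - Φ x + (ε : EReal)}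

/-- The (exact) subdifferential of `Φ` at `x`. -/
def subdiff (B : X →ₗ[ℝ] Y →ₗ[ℝ] ℝ) (Φ : X → EReal) (x : X) : Set Y := epsSubdiff B 0 Φ x

end Dual

/-- The Painlevé–Kuratowski upper limit of the multifunction `M` along the filter `l`: the points
all of whose neighbourhoods `W` satisfy `∀ Z ∈ l, ∃ u ∈ Z, M u ∩ W ≠ ∅`. -/
def upperLimit {U V : Type*} [TopologicalSpace V] (l : Filter U) (M : U → Set V) : Set V :=
  {v | ∀ W ∈ 𝓝 v, ∀ Z ∈ l, ∃ u ∈ Z, (M u ∩ W).Nonempty}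

/-- The filter on the pairs `(μ, ε)` which expresses `με → δ`, `μ → +∞`. -/
def mulTendstoAtTop (δ : ℝ) : Filter (ℝ × ℝ) :=
  comap (fun p : ℝ × ℝ => p.1 * p.2) (𝓝 δ) ⊓ comap Prod.fst atTop

end SublevelNormal

open SublevelNormal

/-!
Let `K ⊆ Y × ℝ` be the convex cone of the pairs `(y, δ)` with `y ∈ ∂_δ(μΦ)(x̄)` for some `μ ≥ 0`.
By Hahn–Banach, applied once to `epi Φ` and once to `K`, the `δ`-normal set of the sublevel set is
the slice at height `δ` of the closure of `K`, and the question is which points the closure adds.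
Under Slater's condition it adds none, by Lagrange duality. Otherwise `x̄` minimises `Φ`, so a
multiplier may be enlarged at will, and since `∂_{με}(μΦ)(x̄) = μ ∂_ε Φ(x̄)` for `μ > 0`, the
closure consists of upper limits of `μ ∂_ε Φ(x̄)` as `μ → +∞`.
-/

namespace SublevelNormal

section Multiplier

variable {V : Type*} [AddCommGroup V] [Module ℝ V] {S : Set V} {f g : V → ℝ}

lemma mul_neg_le_mul_neg_of_concaveOn_of_convexOn (hf : ConcaveOn ℝ S f) (hg : ConvexOn ℝ S g)
    (hfg : ∀ v ∈ S, g v ≤ 0 → f v ≤ 0) {v w : V} (hv : v ∈ S) (hw : w ∈ S)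
    (hgv : 0 < g v) (hgw : g w < 0) : f v * -g w ≤ g v * -f w := by
  have hd : 0 < g v - g w := by linarith
  -- `α` and `β` are the weights at which the chord of `g` from `v` to `w` vanishes.
  set α : ℝ := -g w / (g v - g w) with hα
  set β : ℝ := g v / (g v - g w) with hβ
  have hα0 : 0 ≤ α := div_nonneg (by linarith) hd.le
  have hβ0 : 0 ≤ β := div_nonneg hgv.le hd.le
  have hαβ : α + β = 1 := by rw [hα, hβ]; field_simp; ring
  have hg0 : g (α • v + β • w) ≤ 0 := by
    refine (hg.2 hv hw hα0 hβ0 hαβ).trans_eq ?_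
    simp only [hα, hβ, smul_eq_mul]
    ring
  have hf0 : α * f v + β * f w ≤ 0 :=
    (hf.2 hv hw hα0 hβ0 hαβ).trans (hfg _ (hg.1 hv hw hα0 hβ0 hαβ) hg0)
  have hmul : (g v - g w) * (α * f v + β * f w) = f v * -g w - g v * -f w := by
    rw [hα, hβ]; field_simp; ring
  linarith [mul_nonpos_of_nonneg_of_nonpos hd.le hf0]

theorem exists_nonneg_forall_le_mul (hf : ConcaveOn ℝ S f) (hg : ConvexOn ℝ S g)
    (hslater : ∃ w ∈ S, g w < 0) (hfg : ∀ v ∈ S, g v ≤ 0 → f v ≤ 0) :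
    ∃ μ : ℝ, 0 ≤ μ ∧ ∀ v ∈ S, f v ≤ μ * g v := by
  obtain ⟨w₀, hw₀, hgw₀⟩ := hslater
  set T : Set ℝ := (fun w => f w / g w) '' {w ∈ S | g w < 0}
  have hT_nonneg : ∀ t ∈ T, 0 ≤ t := by
    rintro _ ⟨w, ⟨hw, hgw⟩, rfl⟩
    exact div_nonneg_of_nonpos (hfg w hw hgw.le) hgw.le
  refine ⟨sInf T, Real.sInf_nonneg hT_nonneg, fun v hv => ?_⟩
  rcases lt_trichotomy (g v) 0 with hgv | hgv | hgv
  · exact (le_div_iff_of_neg hgv).1 (csInf_le ⟨0, hT_nonneg⟩ ⟨v, ⟨hv, hgv⟩, rfl⟩)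
  · simpa only [hgv, mul_zero] using hfg v hv hgv.le
  · rw [← div_le_iff₀ hgv]
    refine le_csInf ⟨_, w₀, ⟨hw₀, hgw₀⟩, rfl⟩ ?_
    rintro _ ⟨w, ⟨hw, hgw⟩, rfl⟩
    change f v / g v ≤ f w / g w
    rw [← neg_div_neg_eq (f w), div_le_div_iff₀ hgv (neg_pos.2 hgw), mul_comm (-f w)]
    exact mul_neg_le_mul_neg_of_concaveOn_of_convexOn hf hg hfg hv hw hgv hgw

end Multiplier

section Separation

lemma nonpos_of_forall_add_mul_lt {c t β : ℝ} (h : ∀ s, 0 ≤ s → c + s * t < β) : t ≤ 0 := by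
  by_contra! ht
  have hcβ : c < β := by simpa using h 0 le_rfl
  have := h ((β - c) / t) (div_nonneg (sub_nonneg.2 hcβ.le) ht.le)
  rw [div_mul_cancel₀ _ ht.ne'] at this
  linarith

variable {V W : Type*} [AddCommGroup V] [Module ℝ V] [TopologicalSpace V]
  [AddCommGroup W] [Module ℝ W] {B : V →ₗ[ℝ] W →ₗ[ℝ] ℝ}

lemma exists_strongDual_prod_apply_eq (hV : ∀ f : StrongDual ℝ V, ∃ w, ∀ v, f v = B v w)
    (f : StrongDual ℝ (V × ℝ)) : ∃ w : W, ∃ t : ℝ, ∀ p, f p = B p.1 w + p.2 * t := by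
  obtain ⟨w, hw⟩ := hV (f.comp (ContinuousLinearMap.inl ℝ V ℝ))
  refine ⟨w, f (0, 1), fun p => ?_⟩
  have hp : p = (p.1, 0) + p.2 • (0, 1) := by ext <;> simp
  have hp1 : f (p.1, 0) = B p.1 w := hw p.1
  rw [← hp1, ← smul_eq_mul, ← map_smul, ← map_add, ← hp]

theorem exists_forall_epi_lt_of_notMem_epi [IsTopologicalAddGroup V] [ContinuousSMul ℝ V]
    [LocallyConvexSpace ℝ V] (hV : ∀ f : StrongDual ℝ V, ∃ w, ∀ v, f v = B v w)
    {Φ : V → EReal} (hconv : Convex ℝ (epi Φ)) (hclosed : IsClosed (epi Φ))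
    (hdom : (dom Φ).Nonempty) {p : V × ℝ} (hp : p ∉ epi Φ) :
    ∃ w : W, ∃ τ : ℝ, 0 ≤ τ ∧ ∃ β : ℝ,
      (∀ q ∈ epi Φ, B q.1 w - τ * q.2 < β) ∧ β < B p.1 w - τ * p.2 := by
  obtain ⟨f, β, hf, hβ⟩ := geometric_hahn_banach_closed_point hconv hclosed hp
  obtain ⟨w, t, hft⟩ := exists_strongDual_prod_apply_eq hV f
  have ht : t ≤ 0 := by
    obtain ⟨u, hu⟩ := hdom
    obtain ⟨r, hur, -⟩ := EReal.lt_iff_exists_real_btwn.1 hu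
    refine nonpos_of_forall_add_mul_lt (c := f (u, r)) (β := β) fun s hs => ?_
    have hmem : (u, r + s) ∈ epi Φ :=
      hur.le.trans (EReal.coe_le_coe_iff.2 (le_add_of_nonneg_right hs))
    calc f (u, r) + s * t = f (u, r + s) := by rw [hft, hft]; ring
      _ < β := hf _ hmem
  refine ⟨w, -t, neg_nonneg.2 ht, β, fun q hq => ?_, ?_⟩
  · linarith [hf q hq, hft q]
  · linarith [hft p]

end Separation

lemma mem_upperLimit_mulTendstoAtTop_iff {V : Type*} [TopologicalSpace V] {δ : ℝ}
    {M : ℝ × ℝ → Set V} {v : V} :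
    v ∈ upperLimit (mulTendstoAtTop δ) M ↔ ∀ W ∈ 𝓝 v, ∀ N ∈ 𝓝 δ, ∀ m : ℝ,
      ∃ μ ε : ℝ, μ * ε ∈ N ∧ m ≤ μ ∧ (M (μ, ε) ∩ W).Nonempty := by
  have hbasis := (((𝓝 δ).basis_sets.comap fun p : ℝ × ℝ => p.1 * p.2).inf
    (atTop_basis.comap Prod.fst))
  refine forall₂_congr fun W _ => frequently_iff.symm.trans (hbasis.frequently_iff.trans ?_)
  simp only [Prod.forall, Prod.exists, and_true, id_eq, Set.mem_inter_iff, Set.mem_preimage,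
    Set.mem_Ici, and_assoc]
  exact ⟨fun h N hN m => h N m hN, fun h N m hN => h N hN m⟩

section Scale

variable {X : Type*} {Φ : X → EReal} {x : X}

lemma scale_one (Φ : X → EReal) : scale 1 Φ = Φ := by
  funext x
  unfold scale
  split_ifs with h <;> simp [h]

lemma scale_of_eq_coe {r : ℝ} (hr : Φ x = r) (μ : ℝ) : scale μ Φ x = (μ * r : ℝ) := by
  simp [scale, hr]

lemma coe_le_scale_sub_add_iff {u : X} (hu : Φ u ≠ ⊥) {a : ℝ} (ha : Φ x = a) {μ : ℝ}
    (hμ : 0 ≤ μ) (c δ : ℝ) :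
    (c : EReal) ≤ scale μ Φ u - scale μ Φ x + δ ↔
      ∀ r : ℝ, Φ u ≤ r → c ≤ μ * (r - a) + δ := by
  rw [scale_of_eq_coe ha]
  induction h : Φ u with
  | bot => exact absurd h hu
  | top => simp only [scale, h, if_true, EReal.top_sub_coe, EReal.top_add_coe, le_top, top_le_iff,
      EReal.coe_ne_top, IsEmpty.forall_iff, implies_true]
  | coe t =>
    rw [scale_of_eq_coe h]
    norm_cast
    rw [← mul_sub]
    refine ⟨fun hc r htr => hc.trans ?_, fun hc => hc t le_rfl⟩
    gcongr

end Scale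

section Subdifferential

variable {X Y : Type*} [AddCommGroup X] [Module ℝ X] [AddCommGroup Y] [Module ℝ Y]
  {B : X →ₗ[ℝ] Y →ₗ[ℝ] ℝ} {Φ : X → EReal} {x : X} {a μ δ : ℝ} {y : Y}

lemma mem_epsSubdiff_scale_iff (hbot : ∀ u, Φ u ≠ ⊥) (ha : Φ x = a) (hμ : 0 ≤ μ) :
    y ∈ epsSubdiff B δ (scale μ Φ) x ↔
      ∀ p ∈ epi Φ, B (p.1 - x) y ≤ μ * (p.2 - a) + δ := by
  have hdom : x ∈ dom (scale μ Φ) := (scale_of_eq_coe ha μ).trans_lt (EReal.coe_lt_top _)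
  simp only [epsSubdiff, Set.mem_ofPred_eq, hdom, true_and,
    coe_le_scale_sub_add_iff (hbot _) ha hμ]
  refine ⟨fun h p hp => h.2 p.1 p.2 hp, fun h => ⟨?_, fun u r hr => h (u, r) hr⟩⟩
  simpa using h (x, a) ha.le

lemma smul_epsSubdiff (hbot : ∀ u, Φ u ≠ ⊥) (ha : Φ x = a) (hμ : 0 < μ) (ε : ℝ) :
    μ • epsSubdiff B ε Φ x = epsSubdiff B (μ * ε) (scale μ Φ) x := by
  ext y
  rw [Set.mem_smul_set_iff_inv_smul_mem₀ hμ.ne', ← scale_one Φ,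
    mem_epsSubdiff_scale_iff hbot ha zero_le_one, scale_one, mem_epsSubdiff_scale_iff hbot ha hμ.le]
  refine forall₂_congr fun p _ => ?_
  rw [map_smul, smul_eq_mul, one_mul, ← mul_add, inv_mul_le_iff₀ hμ]

lemma epsSubdiff_scale_zero (hbot : ∀ u, Φ u ≠ ⊥) (hx : x ∈ dom Φ) :
    epsSubdiff B δ (scale 0 Φ) x = normalSet B δ (dom Φ) x := by
  ext y
  rw [mem_epsSubdiff_scale_iff hbot (EReal.coe_toReal hx.ne (hbot x)).symm le_rfl]
  simp only [zero_mul, zero_add]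
  refine ⟨fun h u hu => h (u, (Φ u).toReal) (EReal.le_coe_toReal hu.ne), fun h p hp => ?_⟩
  exact h p.1 (lt_of_le_of_lt hp (EReal.coe_lt_top _))

lemma epsSubdiff_scale_mono (hbot : ∀ u, Φ u ≠ ⊥) (hx : x ∈ dom Φ) (hmin : ∀ u, Φ x ≤ Φ u)
    (hμ : 0 ≤ μ) {ν : ℝ} (hμν : μ ≤ ν) :
    epsSubdiff B δ (scale μ Φ) x ⊆ epsSubdiff B δ (scale ν Φ) x := by
  have ha := (EReal.coe_toReal hx.ne (hbot x)).symm
  intro y hy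
  rw [mem_epsSubdiff_scale_iff hbot ha (hμ.trans hμν)]
  intro p hp
  have hpa : (Φ x).toReal ≤ p.2 := by
    rw [← EReal.coe_le_coe_iff, ← ha]
    exact (hmin p.1).trans hp
  calc B (p.1 - x) y ≤ μ * (p.2 - (Φ x).toReal) + δ :=
        (mem_epsSubdiff_scale_iff hbot ha hμ).1 hy p hp
    _ ≤ ν * (p.2 - (Φ x).toReal) + δ := by gcongr

theorem iUnion_epsSubdiff_zero_scale (hbot : ∀ u, Φ u ≠ ⊥) (hx : x ∈ dom Φ) :
    (⋃ μ ∈ Set.Ici (0 : ℝ), epsSubdiff B 0 (scale μ Φ) x) =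
      Set.Ici (0 : ℝ) • subdiff B Φ x ∪ normalCone B (dom Φ) x := by
  have hpos {μ : ℝ} (hμ : 0 < μ) : epsSubdiff B 0 (scale μ Φ) x = μ • subdiff B Φ x := by
    rw [subdiff, smul_epsSubdiff hbot (EReal.coe_toReal hx.ne (hbot x)).symm hμ, mul_zero]
  have hzero : epsSubdiff B 0 (scale 0 Φ) x = normalCone B (dom Φ) x :=
    epsSubdiff_scale_zero hbot hx
  refine Set.Subset.antisymm (Set.iUnion₂_subset fun μ hμ => ?_) (Set.union_subset ?_ ?_)
  · rcases (Set.mem_Ici.1 hμ).eq_or_lt with rfl | hμ'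
    · exact hzero.subset.trans Set.subset_union_right
    · rw [hpos hμ']
      exact (Set.smul_set_subset_smul hμ).trans Set.subset_union_left
  · rintro _ ⟨μ, hμ, z, hz, rfl⟩
    rcases (Set.mem_Ici.1 hμ).eq_or_lt with rfl | hμ'
    · refine Set.mem_biUnion Set.self_mem_Ici ?_
      rw [hzero]
      intro u _
      simp
    · refine Set.mem_biUnion hμ ?_
      rw [hpos hμ']
      exact Set.smul_mem_smul_set hz
  · rw [← hzero]
    exact Set.subset_biUnion_of_mem (u := fun μ : ℝ => epsSubdiff B 0 (scale μ Φ) x)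
      Set.self_mem_Ici

end Subdifferential

section MultiplierCone

variable {X Y : Type*} [AddCommGroup X] [Module ℝ X] [AddCommGroup Y] [Module ℝ Y]
  {B : X →ₗ[ℝ] Y →ₗ[ℝ] ℝ} {Φ : X → EReal} {x : X} {a δ : ℝ} {y : Y}

/-- For `Φ x = a`, the graph of `δ ↦ ⋃ μ ≥ 0, ∂_δ(μΦ)(x)`. Phrasing the subgradient inequality over
the epigraph avoids extended-real arithmetic and makes this a convex cone for every `Φ` and `a`. -/
def multiplierCone (B : X →ₗ[ℝ] Y →ₗ[ℝ] ℝ) (Φ : X → EReal) (x : X) (a : ℝ) :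
    PointedCone ℝ (Y × ℝ) where
  carrier := {q | ∃ μ : ℝ, 0 ≤ μ ∧ ∀ p ∈ epi Φ, B (p.1 - x) q.1 ≤ μ * (p.2 - a) + q.2}
  zero_mem' := ⟨0, le_rfl, fun p _ => by simp⟩
  add_mem' := by
    rintro q q' ⟨μ, hμ, h⟩ ⟨μ', hμ', h'⟩
    refine ⟨μ + μ', add_nonneg hμ hμ', fun p hp => ?_⟩
    rw [Prod.fst_add, Prod.snd_add, map_add]
    linarith [h p hp, h' p hp]
  smul_mem' := by
    rintro c q ⟨μ, hμ, h⟩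
    refine ⟨c * μ, mul_nonneg c.2 hμ, fun p hp => ?_⟩
    calc B (p.1 - x) ((c : ℝ) • q.1) = c * B (p.1 - x) q.1 := by rw [map_smul, smul_eq_mul]
      _ ≤ c * (μ * (p.2 - a) + q.2) := mul_le_mul_of_nonneg_left (h p hp) c.2
      _ = c * μ * (p.2 - a) + c * q.2 := by ring

lemma mem_multiplierCone_iff (hbot : ∀ u, Φ u ≠ ⊥) (ha : Φ x = a) :
    (y, δ) ∈ multiplierCone B Φ x a ↔
      y ∈ ⋃ μ ∈ Set.Ici (0 : ℝ), epsSubdiff B δ (scale μ Φ) x := by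
  simp only [Set.mem_iUnion₂, Set.mem_Ici, exists_prop]
  exact exists_congr fun μ => and_congr_right fun hμ =>
    (mem_epsSubdiff_scale_iff hbot ha hμ).symm

lemma zero_one_mem_multiplierCone : ((0, 1) : Y × ℝ) ∈ multiplierCone B Φ x a :=
  ⟨0, le_rfl, fun p _ => by simp⟩

lemma apply_sub_le_of_mem_multiplierCone {q : Y × ℝ} (hq : q ∈ multiplierCone B Φ x a) {u : X}
    (hu : Φ u ≤ a) : B (u - x) q.1 ≤ q.2 := by
  obtain ⟨μ, -, h⟩ := hq
  simpa using h (u, a) hu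

theorem mem_multiplierCone_of_slater (hbot : ∀ u, Φ u ≠ ⊥) (hconv : Convex ℝ (epi Φ))
    (ha : Φ x = a) (hS : SlaterAt Φ (Φ x)) (hy : y ∈ normalSet B δ (sublevel Φ (Φ x)) x) :
    (y, δ) ∈ multiplierCone B Φ x a := by
  let f : X × ℝ →ₗ[ℝ] ℝ := (B.flip y).comp (LinearMap.fst ℝ X ℝ)
  have hconcave : ConcaveOn ℝ (epi Φ) fun p => f p + (-B x y - δ) :=
    (f.concaveOn hconv).add_const _
  have hconvex : ConvexOn ℝ (epi Φ) fun p => p.2 + -a :=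
    ((LinearMap.snd ℝ X ℝ).convexOn hconv).add_const _
  have hslater : ∃ p ∈ epi Φ, p.2 + -a < 0 := by
    obtain ⟨x₀, hx₀⟩ := hS
    refine ⟨(x₀, (Φ x₀).toReal), EReal.le_coe_toReal hx₀.ne_top, ?_⟩
    rw [ha, ← EReal.coe_toReal hx₀.ne_top (hbot x₀), EReal.coe_lt_coe_iff] at hx₀
    exact add_neg_neg_iff.2 hx₀
  obtain ⟨μ, hμ, h⟩ := exists_nonneg_forall_le_mul hconcave hconvex hslater fun p hp hpa => by
    have hle : Φ p.1 ≤ Φ x := by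
      rw [ha]
      exact le_trans hp (EReal.coe_le_coe_iff.2 (by linarith))
    have := hy p.1 hle
    rw [map_sub, LinearMap.sub_apply] at this
    change B p.1 y + (-B x y - δ) ≤ 0
    linarith
  refine ⟨μ, hμ, fun p hp => ?_⟩
  have : B p.1 y + (-B x y - δ) ≤ μ * (p.2 + -a) := h p hp
  rw [map_sub, LinearMap.sub_apply, sub_eq_add_neg p.2]
  linarith

theorem iUnion_epsSubdiff_scale_subset_normalSet (hbot : ∀ u, Φ u ≠ ⊥) (hx : x ∈ dom Φ) :
    (⋃ μ ∈ Set.Ici (0 : ℝ), epsSubdiff B δ (scale μ Φ) x) ⊆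
      normalSet B δ (sublevel Φ (Φ x)) x := by
  have ha := (EReal.coe_toReal hx.ne (hbot x)).symm
  exact fun y hy u hu => apply_sub_le_of_mem_multiplierCone
    ((mem_multiplierCone_iff hbot ha).2 hy) (ha ▸ hu)

theorem normalSet_sublevel_eq_iUnion_of_slater (hbot : ∀ u, Φ u ≠ ⊥) (hconv : Convex ℝ (epi Φ))
    (hx : x ∈ dom Φ) (hS : SlaterAt Φ (Φ x)) :
    normalSet B δ (sublevel Φ (Φ x)) x =
      ⋃ μ ∈ Set.Ici (0 : ℝ), epsSubdiff B δ (scale μ Φ) x := by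
  have ha := (EReal.coe_toReal hx.ne (hbot x)).symm
  refine Set.Subset.antisymm (fun y hy => ?_) (iUnion_epsSubdiff_scale_subset_normalSet hbot hx)
  exact (mem_multiplierCone_iff hbot ha).1 (mem_multiplierCone_of_slater hbot hconv ha hS hy)

section UpperLimit

variable [TopologicalSpace Y]

theorem mem_closure_multiplierCone_of_mem_upperLimit (hbot : ∀ u, Φ u ≠ ⊥) (ha : Φ x = a)
    (hy : y ∈ upperLimit (mulTendstoAtTop δ) fun p => p.1 • epsSubdiff B p.2 Φ x) :
    (y, δ) ∈ closure (multiplierCone B Φ x a : Set (Y × ℝ)) := by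
  rw [mem_upperLimit_mulTendstoAtTop_iff] at hy
  refine mem_closure_iff_nhds.2 fun U hU => ?_
  obtain ⟨W, hW, N, hN, hWN⟩ := mem_nhds_prod_iff.1 hU
  obtain ⟨μ, ε, hμε, hμ, z, hz, hzW⟩ := hy W hW N hN 1
  have hμ0 : 0 < μ := one_pos.trans_le hμ
  refine ⟨(z, μ * ε), hWN ⟨hzW, hμε⟩, (mem_multiplierCone_iff hbot ha).2 ?_⟩
  refine Set.mem_biUnion hμ0.le ?_
  rwa [← smul_epsSubdiff hbot ha hμ0]

theorem mem_upperLimit_of_mem_closure_multiplierCone (hbot : ∀ u, Φ u ≠ ⊥) (ha : Φ x = a)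
    (hmin : ∀ u, Φ x ≤ Φ u)
    (hy : (y, δ) ∈ closure (multiplierCone B Φ x a : Set (Y × ℝ))) :
    y ∈ upperLimit (mulTendstoAtTop δ) fun p => p.1 • epsSubdiff B p.2 Φ x := by
  refine mem_upperLimit_mulTendstoAtTop_iff.2 fun W hW N hN m => ?_
  obtain ⟨⟨z, s⟩, ⟨hzW, hsN⟩, hz⟩ := mem_closure_iff_nhds.1 hy _ (prod_mem_nhds hW hN)
  obtain ⟨μ, hμ, hzμ⟩ := Set.mem_iUnion₂.1 ((mem_multiplierCone_iff hbot ha).1 hz)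
  set ν : ℝ := max (max μ m) 1
  have hν : 0 < ν := one_pos.trans_le (le_max_right _ _)
  have hμν : μ ≤ ν := (le_max_left _ _).trans (le_max_left _ _)
  have hνs : ν * (s / ν) = s := mul_div_cancel₀ s hν.ne'
  have hx : x ∈ dom Φ := ha.trans_lt (EReal.coe_lt_top a)
  refine ⟨ν, s / ν, hνs.symm ▸ hsN, (le_max_right _ _).trans (le_max_left _ _), z, ?_, hzW⟩
  simp only [smul_epsSubdiff hbot ha hν, hνs]
  exact epsSubdiff_scale_mono hbot hx hmin hμ hμν hzμ

end UpperLimit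

section Bipolar

variable [TopologicalSpace X] [IsTopologicalAddGroup X] [ContinuousSMul ℝ X]
  [LocallyConvexSpace ℝ X]

theorem exists_mem_multiplierCone_lt_apply_sub
    (hX : ∀ f : StrongDual ℝ X, ∃ y, ∀ u, f u = B u y) (hconv : Convex ℝ (epi Φ))
    (hclosed : IsClosed (epi Φ)) (ha : Φ x = a) {u : X} (hu : Φ x < Φ u) :
    ∃ q ∈ multiplierCone B Φ x a, q.2 < B (u - x) q.1 := by
  obtain ⟨r, har, hru⟩ := EReal.lt_iff_exists_real_btwn.1 (ha ▸ hu)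
  obtain ⟨y, τ, hτ, β, hepi, hβ⟩ := exists_forall_epi_lt_of_notMem_epi hX hconv hclosed
    ⟨x, ha.trans_lt (EReal.coe_lt_top a)⟩ (p := (u, r)) (not_le.2 hru)
  refine ⟨(y, β - B x y + τ * a), ⟨τ, hτ, fun p hp => ?_⟩, ?_⟩
  · rw [map_sub, LinearMap.sub_apply]
    linarith [hepi p hp]
  · have : τ * a ≤ τ * r := mul_le_mul_of_nonneg_left (EReal.coe_lt_coe_iff.1 har).le hτ
    rw [map_sub, LinearMap.sub_apply]
    linarith

variable [TopologicalSpace Y] [IsTopologicalAddGroup Y] [ContinuousSMul ℝ Y]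
  [LocallyConvexSpace ℝ Y]

theorem normalSet_sublevel_subset_closure_multiplierCone
    (hX : ∀ f : StrongDual ℝ X, ∃ y, ∀ u, f u = B u y)
    (hY : ∀ g : StrongDual ℝ Y, ∃ u, ∀ y, g y = B u y) (hconv : Convex ℝ (epi Φ))
    (hclosed : IsClosed (epi Φ)) (ha : Φ x = a)
    (hy : y ∈ normalSet B δ (sublevel Φ (Φ x)) x) :
    (y, δ) ∈ closure (multiplierCone B Φ x a : Set (Y × ℝ)) := by
  by_contra hnot
  obtain ⟨f, hf, hfy⟩ := ProperCone.hyperplane_separation_point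
    (Submodule.closure (multiplierCone B Φ x a)) hnot
  replace hf : ∀ q ∈ multiplierCone B Φ x a, 0 ≤ f q := fun q hq => hf q (subset_closure hq)
  obtain ⟨u, t, hft⟩ := exists_strongDual_prod_apply_eq (B := B.flip) hY f
  simp only [hft, LinearMap.flip_apply] at hf hfy
  have ht : 0 ≤ t := by simpa using hf _ zero_one_mem_multiplierCone
  -- Hahn–Banach only gives `0 ≤ t`; a slightly larger slope still separates `(y, δ)` from the cone.
  obtain ⟨τ, htτ, hτ⟩ : ∃ τ > t, B u y + δ * τ < 0 :=
    ((by fun_prop : ContinuousAt (fun τ => B u y + δ * τ) t).eventually_lt_const hfy).exists_gt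
  have hτ0 : 0 < τ := ht.trans_lt htτ
  have hpoint (w : Y) (s : ℝ) : B (x - τ⁻¹ • u - x) w ≤ s ↔ 0 ≤ B u w + s * τ := by
    rw [sub_sub_cancel_left, map_neg, map_smul, LinearMap.neg_apply, LinearMap.smul_apply,
      smul_eq_mul, neg_le, ← div_eq_inv_mul, le_div_iff₀ hτ0, neg_mul, neg_le_iff_add_nonneg]
  by_cases hmem : Φ (x - τ⁻¹ • u) ≤ Φ x
  · exact hτ.not_ge ((hpoint y δ).1 (hy _ hmem))
  · obtain ⟨q, hq, hlt⟩ :=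
      exists_mem_multiplierCone_lt_apply_sub hX hconv hclosed ha (not_le.1 hmem)
    have hq2 : 0 ≤ q.2 := by simpa using apply_sub_le_of_mem_multiplierCone hq ha.le
    refine hlt.not_ge ((hpoint q.1 q.2).2 ?_)
    calc 0 ≤ B u q.1 + q.2 * t := hf q hq
      _ ≤ B u q.1 + q.2 * τ := by gcongr

theorem mem_closure_multiplierCone_iff (hX : ∀ f : StrongDual ℝ X, ∃ y, ∀ u, f u = B u y)
    (hB : ∀ u, Continuous (B u)) (hY : ∀ g : StrongDual ℝ Y, ∃ u, ∀ y, g y = B u y)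
    (hconv : Convex ℝ (epi Φ)) (hclosed : IsClosed (epi Φ)) (ha : Φ x = a) :
    (y, δ) ∈ closure (multiplierCone B Φ x a : Set (Y × ℝ)) ↔
      y ∈ normalSet B δ (sublevel Φ (Φ x)) x := by
  refine ⟨fun h u hu => ?_,
    normalSet_sublevel_subset_closure_multiplierCone hX hY hconv hclosed ha⟩
  have hhalf : IsClosed {q : Y × ℝ | B (u - x) q.1 ≤ q.2} :=
    isClosed_le ((hB _).comp continuous_fst) continuous_snd
  exact closure_minimal (fun q hq => apply_sub_le_of_mem_multiplierCone hq (ha ▸ hu)) hhalf h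

end Bipolar

end MultiplierCone

namespace IsDualPair

variable {X Y : Type*} [AddCommGroup X] [Module ℝ X] [TopologicalSpace X]
  [AddCommGroup Y] [Module ℝ Y] [TopologicalSpace Y] {B : X →ₗ[ℝ] Y →ₗ[ℝ] ℝ}

lemma exists_forall_strongDual_left_eq (hB : IsDualPair B) (f : StrongDual ℝ X) :
    ∃ y, ∀ x, f x = B x y :=
  ((hB.compatibleLeft f.toLinearMap).1 f.continuous).imp fun _ h => LinearMap.congr_fun h

lemma exists_forall_strongDual_right_eq (hB : IsDualPair B) (g : StrongDual ℝ Y) :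
    ∃ x, ∀ y, g y = B x y :=
  ((hB.compatibleRight g.toLinearMap).1 g.continuous).imp fun _ h => LinearMap.congr_fun h

lemma continuous_apply (hB : IsDualPair B) (x : X) : Continuous (B x) :=
  (hB.compatibleRight _).2 ⟨x, rfl⟩

end IsDualPair

end SublevelNormal

theorem corollary3p7_general {X Y : Type*}
    [AddCommGroup X] [Module ℝ X] [TopologicalSpace X] [IsTopologicalAddGroup X]
    [ContinuousSMul ℝ X] [LocallyConvexSpace ℝ X]
    [AddCommGroup Y] [Module ℝ Y] [TopologicalSpace Y] [IsTopologicalAddGroup Y]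
    [ContinuousSMul ℝ Y] [LocallyConvexSpace ℝ Y]
    (B : X →ₗ[ℝ] Y →ₗ[ℝ] ℝ) (hX : ∀ f : StrongDual ℝ X, ∃ y, ∀ u, f u = B u y)
    (hB : ∀ u, Continuous (B u)) (hY : ∀ g : StrongDual ℝ Y, ∃ u, ∀ y, g y = B u y)
    (Φ : X → EReal) (hΦ : IsGammaZero Φ) (xbar : X) (hx : xbar ∈ dom Φ) :
    (∀ δ : ℝ, normalSet B δ (sublevel Φ (Φ xbar)) xbar =
      (⋃ μ ∈ Set.Ici (0 : ℝ), epsSubdiff B δ (scale μ Φ) xbar) ∪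
        upperLimit (mulTendstoAtTop δ) (fun p => p.1 • epsSubdiff B p.2 Φ xbar)) ∧
    normalCone B (sublevel Φ (Φ xbar)) xbar =
      Set.Ici (0 : ℝ) • subdiff B Φ xbar ∪ normalCone B (dom Φ) xbar ∪
        upperLimit (mulTendstoAtTop 0) (fun p => p.1 • epsSubdiff B p.2 Φ xbar) ∧
    (SlaterAt Φ (Φ xbar) → ∀ δ : ℝ, normalSet B δ (sublevel Φ (Φ xbar)) xbar =
      ⋃ μ ∈ Set.Ici (0 : ℝ), epsSubdiff B δ (scale μ Φ) xbar) := by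
  have hbot := hΦ.ne_bot
  have ha := (EReal.coe_toReal hx.ne (hbot xbar)).symm
  have hclosure {δ : ℝ} {y : Y} := mem_closure_multiplierCone_iff (δ := δ) (y := y) hX hB hY
    hΦ.convex_epi hΦ.isClosed_epi ha
  have hslater (hS : SlaterAt Φ (Φ xbar)) (δ : ℝ) :=
    normalSet_sublevel_eq_iUnion_of_slater (B := B) (δ := δ) hbot hΦ.convex_epi hx hS
  have hmain (δ : ℝ) : normalSet B δ (sublevel Φ (Φ xbar)) xbar =
      (⋃ μ ∈ Set.Ici (0 : ℝ), epsSubdiff B δ (scale μ Φ) xbar) ∪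
        upperLimit (mulTendstoAtTop δ) (fun p => p.1 • epsSubdiff B p.2 Φ xbar) := by
    refine Set.Subset.antisymm (fun y hy => ?_) <| Set.union_subset
      (iUnion_epsSubdiff_scale_subset_normalSet hbot hx) fun y hy =>
        hclosure.1 (mem_closure_multiplierCone_of_mem_upperLimit hbot ha hy)
    by_cases hS : SlaterAt Φ (Φ xbar)
    · exact Or.inl ((hslater hS δ).subset hy)
    · have hmin (u : X) : Φ xbar ≤ Φ u := not_lt.1 fun h => hS ⟨u, h⟩
      exact Or.inr (mem_upperLimit_of_mem_closure_multiplierCone hbot ha hmin (hclosure.2 hy))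
  refine ⟨hmain, ?_, hslater⟩
  rw [← iUnion_epsSubdiff_zero_scale hbot hx]
  exact hmain 0

theorem corollary3p7 {X Y : Type*}
    [AddCommGroup X] [Module ℝ X] [TopologicalSpace X] [IsTopologicalAddGroup X]
    [ContinuousSMul ℝ X] [LocallyConvexSpace ℝ X]
    [AddCommGroup Y] [Module ℝ Y] [TopologicalSpace Y] [IsTopologicalAddGroup Y]
    [ContinuousSMul ℝ Y] [LocallyConvexSpace ℝ Y]
    (B : X →ₗ[ℝ] Y →ₗ[ℝ] ℝ) (hB : IsDualPair B)
    (Φ : X → EReal) (hΦ : IsGammaZero Φ) (xbar : X) (hx : xbar ∈ dom Φ) :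
    (∀ δ : ℝ, 0 ≤ δ →
      normalSet B δ (sublevel Φ (Φ xbar)) xbar =
        (⋃ μ ∈ Set.Ici (0 : ℝ), epsSubdiff B δ (scale μ Φ) xbar) ∪
          upperLimit (mulTendstoAtTop δ) (fun p => p.1 • epsSubdiff B p.2 Φ xbar)) ∧
    normalCone B (sublevel Φ (Φ xbar)) xbar =
      Set.Ici (0 : ℝ) • subdiff B Φ xbar ∪ normalCone B (dom Φ) xbar ∪
        upperLimit (mulTendstoAtTop 0) (fun p => p.1 • epsSubdiff B p.2 Φ xbar) ∧
    (SlaterAt Φ (Φ xbar) → ∀ δ : ℝ, 0 ≤ δ →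
      normalSet B δ (sublevel Φ (Φ xbar)) xbar =
        ⋃ μ ∈ Set.Ici (0 : ℝ), epsSubdiff B δ (scale μ Φ) xbar) := by
  obtain ⟨hmain, hcone, hslater⟩ := corollary3p7_general B
    hB.exists_forall_strongDual_left_eq hB.continuous_apply hB.exists_forall_strongDual_right_eq
    Φ hΦ xbar hx
  exact ⟨fun δ _ => hmain δ, hcone, fun hS δ _ => hslater hS δ⟩
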